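/- Throughout, $k$ is a non-zero commutative unital ring, and algebras are associative $k$-algebras, not necessarily unital. For an algebra $I$, a multiplier of $I$ is a pair $w=(R,L)$ of an endomorphism $x\mapsto xw:=xR$ of the left $I$-module $I$ and an endomorphism $x\mapsto wx:=Lx$ of the right $I$-module $I$ (both $k$-linear) with $(xw)y=x(wy)$ for all $x,y\in I$; the multipliers form a unital algebra $\mathcal M(I)$. Products of submodules denote all finite sums of products of elements. A twisted partial action $\Theta$ of a group $G$ on an algebra $\mathcal A$ consists of two-sided ideals $\mathcal D_g$ of $\mathcal A$, $k$-algebra isomorphisms $\theta_g:\mathcal D_{g^{-1}}\to\mathcal D_g$ $(g\in G)$ and invertible elements $w_{g,h}\in\mathcal M(\mathcal D_g\mathcal D_{gh})$ $(g,h\in G)$ such that for all $g,h,t\in G$: (i) $\mathcal D_g^2=\mathcal D_g$ and $\mathcal D_g\mathcal D_h=\mathcal D_h\mathcal D_g$; (ii) $\mathcal D_1=\mathcal A$ and $\theta_1=\mathrm{id}$; (iii) $\theta_g(\mathcal D_{g^{-1}}\mathcal D_h)=\mathcal D_g\mathcal D_{gh}$; (iv) $\theta_g(\theta_h(a))=w_{g,h}\,\theta_{gh}(a)\,w_{g,h}^{-1}$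 for $a\in\mathcal D_{h^{-1}}\mathcal D_{h^{-1}g^{-1}}$; (v) $w_{1,g}=w_{g,1}=1$; (vi) $\theta_g(a\,w_{h,t})\,w_{g,ht}=\theta_g(a)\,w_{g,h}\,w_{gh,t}$ for $a\in\mathcal D_{g^{-1}}\mathcal D_h\mathcal D_{ht}$. The crossed product $\mathcal A\rtimes_\Theta G$ is $\bigoplus_{g\in G}\mathcal D_g\delta_g$, graded by $G$ in the evident way, with multiplication $(a\delta_g)(b\delta_h)=\theta_g(\theta_g^{-1}(a)\,b)\,w_{g,h}\,\delta_{gh}$. For a non-zero cardinal $\gamma$, $\mathrm{FMat}_\gamma(\mathcal B)$ is the algebra of $\gamma\times\gamma$-matrices over $\mathcal B$ with only finitely many non-zero entries; if $\mathcal B=\bigoplus_{h\in G}\mathcal B_h$ is $G$-graded, its $h$-homogeneous component is $\mathrm{FMat}_\gamma(\mathcal B_h)$. **Statement.** Let $G$ be a group with an element $g$ such that $g^2\neq 1$. Then there is a $G$-graded $k$-algebra $\mathcal B=\bigoplus_{h\in G}\mathcal B_h$ such that 1. $\mathcal B$ is homogeneously non-degenerate: for all $h\in G$ and $0\neq x\in\mathcal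 B_h$ one has $x\,\mathcal B_{h^{-1}}\neq 0$ and $\mathcal B_{h^{-1}}x\neq 0$; 2. $\mathcal B_h\mathcal B_{h^{-1}}\mathcal B_h=\mathcal B_h$ for all $h\in G$; 3. for every $h\in G$ the ring $R=\mathcal B_h\mathcal B_{h^{-1}}$ has local units, i.e. every $r\in R$ lies in $eRe$ for some idempotent $e\in R$; 4. for every non-zero cardinal $\gamma$ and every twisted partial action $\Theta$ of $G$ on $\mathrm{FMat}_\gamma(\mathcal B_1)$, the graded algebras $\mathrm{FMat}_\gamma(\mathcal B)$ and $\mathrm{FMat}_\gamma(\mathcal B_1)\rtimes_\Theta G$ are not isomorphic as graded algebras. Remark (context, not part of the claim). It is a theorem that if 2 holds and every ring $R=\mathcal B_h\mathcal B_{h^{-1}}$ has orthogonal local units (a set $E$ of pairwise orthogonal idempotents with $R=\bigoplus_{e\in E}Re=\bigoplus_{e\in E}eR$), then $\mathrm{FMat}_\gamma(\mathcal B)$ is a crossed product as in 4 for some infinite $\gamma$; items 2–4 say that orthogonality cannot be dropped there. -/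

import Mathlib

/-! Throughout, `k` is a commutative unital ring and a `k`-algebra `A` is associative and not
necessarily unital: `[NonUnitalRing A] [Module k A] [IsScalarTower k A A] [SMulCommClass k A A]`. -/

namespace TwistedPartial

/-! ### Products of submodules and two-sided ideals -/

section Ideals

variable {k : Type*} {A : Type*} [CommRing k] [NonUnitalRing A] [Module k A]

/-- The product `M N`: all finite sums of elements `m * n` with `m ∈ M`, `n ∈ N`. -/
def mulSub (M N : Submodule k A) : Submodule k A :=
  Submodule.span k {x | ∃ m ∈ M, ∃ n ∈ N, m * n = x}

theorem mul_mem_mulSub {M N : Submodule k A} {m n : A} (hm : m ∈ M) (hn : n ∈ N) :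
    m * n ∈ mulSub M N :=
  Submodule.subset_span ⟨m, hm, n, hn, rfl⟩

theorem mulSub_le {M N P : Submodule k A} :
    mulSub M N ≤ P ↔ ∀ m ∈ M, ∀ n ∈ N, m * n ∈ P := by
  refine ⟨fun h m hm n hn => h (mul_mem_mulSub hm hn), fun h => Submodule.span_le.2 ?_⟩
  rintro _ ⟨m, hm, n, hn, rfl⟩
  exact h m hm n hn

variable (k A) in
/-- Two-sided ideals of the `k`-algebra `A`. -/
structure AlgIdeal extends Submodule k A where
  mul_mem_left' : ∀ (a : A) {x : A}, x ∈ carrier → a * x ∈ carrier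
  mul_mem_right' : ∀ (a : A) {x : A}, x ∈ carrier → x * a ∈ carrier

namespace AlgIdeal

theorem toSubmodule_injective :
    Function.Injective (AlgIdeal.toSubmodule : AlgIdeal k A → Submodule k A) := by
  rintro ⟨I, _, _⟩ ⟨J, _, _⟩ h
  cases h
  rfl

instance : SetLike (AlgIdeal k A) A where
  coe I := I.toSubmodule
  coe_injective _ _ h := toSubmodule_injective (SetLike.coe_injective h)

theorem mem_toSubmodule {I : AlgIdeal k A} {x : A} : x ∈ I.toSubmodule ↔ x ∈ I := Iff.rfl

theorem mul_mem_left (I : AlgIdeal k A) (a : A) {x : A} (hx : x ∈ I) : a * x ∈ I :=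
  I.mul_mem_left' a hx

theorem mul_mem_right (I : AlgIdeal k A) (a : A) {x : A} (hx : x ∈ I) : x * a ∈ I :=
  I.mul_mem_right' a hx

instance : NonUnitalSubringClass (AlgIdeal k A) A where
  add_mem {I} _ _ ha hb := I.toSubmodule.add_mem ha hb
  zero_mem I := I.toSubmodule.zero_mem
  neg_mem {I} _ ha := I.toSubmodule.neg_mem ha
  mul_mem {I} a _ _ hb := I.mul_mem_left a hb

instance : SMulMemClass (AlgIdeal k A) k A where
  smul_mem {I} c _ hx := I.toSubmodule.smul_mem c hx

instance : Top (AlgIdeal k A) :=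
  ⟨{ (⊤ : Submodule k A) with
      mul_mem_left' := fun _ _ _ => trivial
      mul_mem_right' := fun _ _ _ => trivial }⟩

variable [IsScalarTower k A A] [SMulCommClass k A A]

/-- The product of two ideals. -/
instance : Mul (AlgIdeal k A) :=
  ⟨fun I J =>
    { mulSub I.toSubmodule J.toSubmodule with
      mul_mem_left' := by
        intro a x hx
        have h : mulSub I.toSubmodule J.toSubmodule ≤
            (mulSub I.toSubmodule J.toSubmodule).comap (LinearMap.mulLeft k a) := by
          refine mulSub_le.2 fun m hm n hn => ?_
          simp only [Submodule.mem_comap, LinearMap.mulLeft_apply, ← mul_assoc]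
          exact mul_mem_mulSub (I.mul_mem_left a hm) hn
        exact h hx
      mul_mem_right' := by
        intro a x hx
        have h : mulSub I.toSubmodule J.toSubmodule ≤
            (mulSub I.toSubmodule J.toSubmodule).comap (LinearMap.mulRight k a) := by
          refine mulSub_le.2 fun m hm n hn => ?_
          simp only [Submodule.mem_comap, LinearMap.mulRight_apply, mul_assoc]
          exact mul_mem_mulSub hm (J.mul_mem_right a hn)
        exact h hx }⟩

theorem toSubmodule_mul (I J : AlgIdeal k A) :
    (I * J).toSubmodule = mulSub I.toSubmodule J.toSubmodule := rfl

theorem mul_mem_mul {I J : AlgIdeal k A} {x y : A} (hx : x ∈ I) (hy : y ∈ J) : x * y ∈ I * J :=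
  mul_mem_mulSub (M := I.toSubmodule) (N := J.toSubmodule) hx hy

theorem mul_le_iff {I J : AlgIdeal k A} {P : Submodule k A} :
    (∀ x ∈ I * J, x ∈ P) ↔ ∀ x ∈ I, ∀ y ∈ J, x * y ∈ P :=
  mulSub_le (M := I.toSubmodule) (N := J.toSubmodule)

theorem mem_left_of_mem_mul {I J : AlgIdeal k A} {x : A} (hx : x ∈ I * J) : x ∈ I :=
  mul_le_iff (P := I.toSubmodule).2 (fun _ ha b _ => I.mul_mem_right b ha) x hx

theorem mem_right_of_mem_mul {I J : AlgIdeal k A} {x : A} (hx : x ∈ I * J) : x ∈ J :=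
  mul_le_iff (P := J.toSubmodule).2 (fun a _ _ hb => J.mul_mem_left a hb) x hx

theorem mul_mono {I I' J J' : AlgIdeal k A} (hI : ∀ x ∈ I, x ∈ I') (hJ : ∀ x ∈ J, x ∈ J')
    {x : A} (hx : x ∈ I * J) : x ∈ I' * J' :=
  mul_le_iff (P := (I' * J').toSubmodule).2
    (fun a ha b hb => mul_mem_mul (hI a ha) (hJ b hb)) x hx

protected theorem mul_assoc (I J K : AlgIdeal k A) : I * J * K = I * (J * K) := by
  refine SetLike.ext fun x => ⟨fun hx => ?_, fun hx => ?_⟩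
  · refine mul_le_iff (P := (I * (J * K)).toSubmodule).2 (fun a ha c hc => ?_) x hx
    refine mul_le_iff (P := ((I * (J * K)).toSubmodule).comap (LinearMap.mulRight k c)).2
      (fun i hi j hj => ?_) a ha
    simp only [Submodule.mem_comap, LinearMap.mulRight_apply, mul_assoc]
    exact mul_mem_mul hi (mul_mem_mul hj hc)
  · refine mul_le_iff (P := (I * J * K).toSubmodule).2 (fun i hi a ha => ?_) x hx
    refine mul_le_iff (P := ((I * J * K).toSubmodule).comap (LinearMap.mulLeft k i)).2
      (fun j hj c hc => ?_) a ha
    simp only [Submodule.mem_comap, LinearMap.mulLeft_apply, ← mul_assoc]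
    exact mul_mem_mul (mul_mem_mul hi hj) hc

theorem mul_comm_of {G : Type*} {D : G → AlgIdeal k A} (hD : ∀ g h, D g * D h = D h * D g)
    (a b c : G) : D a * D b * D c = D c * (D a * D b) := by
  rw [AlgIdeal.mul_assoc, hD b c, ← AlgIdeal.mul_assoc, hD a c, AlgIdeal.mul_assoc]

end AlgIdeal

end Ideals

/-! ### Multipliers -/

/-- A multiplier of the `k`-algebra `I`: a pair of a right multiplier `x ↦ x R` (an endomorphism of
the left `I`-module `I`, here the function `right`) and a left multiplier `x ↦ L x` (an
endomorphism of the right `I`-module `I`, here the function `left`) with `(x R) y = x (L y)`. -/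
@[ext]
structure Multiplier (k : Type*) (I : Type*) [CommRing k] [NonUnitalRing I] [Module k I] where
  right : I →ₗ[k] I
  left : I →ₗ[k] I
  right_mul : ∀ x y, right (x * y) = x * right y
  left_mul : ∀ x y, left (x * y) = left x * y
  compat : ∀ x y, right x * y = x * left y

namespace Multiplier

variable {k : Type*} {I : Type*} [CommRing k] [NonUnitalRing I] [Module k I]

/-- The multiplicative monoid of the multiplier algebra: `x (w w') = (x w) w'` and
`(w w') x = w (w' x)`. -/
instance : Monoid (Multiplier k I) where
  one := ⟨LinearMap.id, LinearMap.id, fun _ _ => rfl, fun _ _ => rfl, fun _ _ => rfl⟩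
  mul m n :=
    ⟨n.right ∘ₗ m.right, m.left ∘ₗ n.left,
      fun x y => by simp [right_mul], fun x y => by simp [left_mul],
      fun x y => by simp [compat]⟩
  mul_assoc _ _ _ := rfl
  one_mul _ := rfl
  mul_one _ := rfl

/-- A right multiplier of an idempotent ideal `I` maps `J I` into itself. -/
theorem right_mem {A : Type*} [NonUnitalRing A] [Module k A] [IsScalarTower k A A]
    [SMulCommClass k A A] {I J : AlgIdeal k A} (hI : I * I = I) (m : Multiplier k I) {x : I}
    (hx : (x : A) ∈ J * I) : (m.right x : A) ∈ J * I := by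
  let P : Submodule k A :=
    (((J * I).toSubmodule.comap I.toSubmodule.subtype).comap m.right).map I.toSubmodule.subtype
  have hP : (x : A) ∈ P := by
    have hx' : (x : A) ∈ (J * I) * I := by rwa [AlgIdeal.mul_assoc, hI]
    refine AlgIdeal.mul_le_iff (P := P).2 (fun a ha b hb => ?_) x hx'
    have ha' := AlgIdeal.mem_right_of_mem_mul ha
    refine ⟨(⟨a, ha'⟩ : I) * ⟨b, hb⟩, ?_, rfl⟩
    change ((m.right (⟨a, ha'⟩ * ⟨b, hb⟩) : I) : A) ∈ J * I
    rw [m.right_mul]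
    exact (J * I).mul_mem_right _ ha
  obtain ⟨z, hz, hzx⟩ := hP
  have hzx' : z = x := Subtype.ext hzx
  subst hzx'
  exact hz

end Multiplier

/-! ### Twisted partial actions -/

section Actions

variable (k : Type*) (G : Type*) (A : Type*) [CommRing k] [Group G] [NonUnitalRing A] [Module k A]
  [IsScalarTower k A A] [SMulCommClass k A A]

/-- The ideals `D g` and isomorphisms `θ g` of a twisted partial action, with those postulates
that do not involve the twisting. -/
structure PartialDatum where
  D : G → AlgIdeal k A
  θ : ∀ g : G, D g⁻¹ ≃ₗ[k] D g
  θ_mul : ∀ (g : G) (x y : D g⁻¹), θ g (x * y) = θ g x * θ g y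
  D_idem : ∀ g, D g * D g = D g
  D_comm : ∀ g h, D g * D h = D h * D g
  D_one : D 1 = ⊤
  θ_one : ∀ x : D (1 : G)⁻¹, (θ 1 x : A) = x
  θ_image : ∀ g h : G,
    {a : A | ∃ x : D g⁻¹, (x : A) ∈ D g⁻¹ * D h ∧ (θ g x : A) = a} =
      {a : A | a ∈ D g * D (g * h)}

variable {k G A}

namespace PartialDatum

variable (Θ : PartialDatum k G A)

theorem θ_mem {g h : G} {x : Θ.D g⁻¹} (hx : (x : A) ∈ Θ.D g⁻¹ * Θ.D h) :
    (Θ.θ g x : A) ∈ Θ.D g * Θ.D (g * h) := by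
  have h' : (Θ.θ g x : A) ∈ {a : A | a ∈ Θ.D g * Θ.D (g * h)} := by
    rw [← Θ.θ_image g h]
    exact ⟨x, hx, rfl⟩
  exact h'

/-- `θ g` as a map from `D g⁻¹ D h` to `D g D (g h)`. -/
def θres (g h : G) (x : A) (hx : x ∈ Θ.D g⁻¹ * Θ.D h) : ↥(Θ.D g * Θ.D (g * h)) :=
  ⟨Θ.θ g ⟨x, AlgIdeal.mem_left_of_mem_mul hx⟩, Θ.θ_mem hx⟩

theorem θres_add {g h : G} {x y : A} (hx : x ∈ Θ.D g⁻¹ * Θ.D h) (hy : y ∈ Θ.D g⁻¹ * Θ.D h) :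
    Θ.θres g h (x + y) (add_mem hx hy) = Θ.θres g h x hx + Θ.θres g h y hy :=
  Subtype.ext (congrArg (Subtype.val : Θ.D g → A) (map_add (Θ.θ g)
    ⟨x, AlgIdeal.mem_left_of_mem_mul hx⟩ ⟨y, AlgIdeal.mem_left_of_mem_mul hy⟩))

theorem θres_smul {g h : G} (c : k) {x : A} (hx : x ∈ Θ.D g⁻¹ * Θ.D h) :
    Θ.θres g h (c • x) (SMulMemClass.smul_mem c hx) = c • Θ.θres g h x hx :=
  Subtype.ext (congrArg (Subtype.val : Θ.D g → A) (map_smul (Θ.θ g) c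
    ⟨x, AlgIdeal.mem_left_of_mem_mul hx⟩))

theorem mul_idem (g h : G) :
    (Θ.D g * Θ.D h) * (Θ.D g * Θ.D h) = Θ.D g * Θ.D h := by
  rw [AlgIdeal.mul_assoc, ← AlgIdeal.mul_assoc (Θ.D h), Θ.D_comm h g, AlgIdeal.mul_assoc,
    Θ.D_idem, ← AlgIdeal.mul_assoc, Θ.D_idem]

theorem mul_three (g h t : G) :
    Θ.D g * (Θ.D h * Θ.D t) = (Θ.D g * Θ.D h) * (Θ.D g * Θ.D t) := by
  conv_lhs => rw [← Θ.D_idem g]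
  rw [AlgIdeal.mul_assoc, AlgIdeal.mul_assoc, ← AlgIdeal.mul_assoc (Θ.D g) (Θ.D h),
    Θ.D_comm g h, AlgIdeal.mul_assoc]

theorem θ_mem_three {g h t : G} {x : Θ.D g⁻¹}
    (hx : (x : A) ∈ Θ.D g⁻¹ * (Θ.D h * Θ.D t)) :
    (Θ.θ g x : A) ∈ Θ.D g * (Θ.D (g * h) * Θ.D (g * t)) := by
  rw [mul_three] at hx ⊢
  let P : Submodule k A :=
    ((((Θ.D g * Θ.D (g * h)) * (Θ.D g * Θ.D (g * t))).toSubmodule.comap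
      (Θ.D g).toSubmodule.subtype).comap (Θ.θ g).toLinearMap).map
        (Θ.D g⁻¹).toSubmodule.subtype
  have hP : (x : A) ∈ P := by
    refine AlgIdeal.mul_le_iff (P := P).2 (fun a ha b hb => ?_) x hx
    have ha' := AlgIdeal.mem_left_of_mem_mul ha
    have hb' := AlgIdeal.mem_left_of_mem_mul hb
    refine ⟨(⟨a, ha'⟩ : Θ.D g⁻¹) * ⟨b, hb'⟩, ?_, rfl⟩
    change ((Θ.θ g (⟨a, ha'⟩ * ⟨b, hb'⟩) : Θ.D g) : A) ∈
      (Θ.D g * Θ.D (g * h)) * (Θ.D g * Θ.D (g * t))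
    rw [Θ.θ_mul]
    exact AlgIdeal.mul_mem_mul (Θ.θ_mem (x := ⟨a, ha'⟩) ha) (Θ.θ_mem (x := ⟨b, hb'⟩) hb)
  obtain ⟨z, hz, hzx⟩ := hP
  have hzx' : z = x := Subtype.ext hzx
  subst hzx'
  exact hz

theorem mem_iv₁ {g h : G} {a : A} (ha : a ∈ Θ.D h⁻¹ * Θ.D (g * h)⁻¹) :
    (Θ.θ h ⟨a, AlgIdeal.mem_left_of_mem_mul ha⟩ : A) ∈ Θ.D g⁻¹ := by
  have h1 := AlgIdeal.mem_right_of_mem_mul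
    (Θ.θ_mem (x := ⟨a, AlgIdeal.mem_left_of_mem_mul ha⟩) ha)
  have h2 : h * (g * h)⁻¹ = g⁻¹ := by group
  rwa [h2] at h1

theorem mem_iv₂ {g h : G} {a : A} (ha : a ∈ Θ.D h⁻¹ * Θ.D (g * h)⁻¹) :
    (Θ.θ (g * h) ⟨a, AlgIdeal.mem_right_of_mem_mul ha⟩ : A) ∈ Θ.D g * Θ.D (g * h) := by
  have h1 := Θ.θ_mem (g := g * h) (h := h⁻¹) (x := ⟨a, AlgIdeal.mem_right_of_mem_mul ha⟩)
    (by rw [Θ.D_comm]; exact ha)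
  rwa [mul_inv_cancel_right, Θ.D_comm] at h1

theorem mem_vi₁ {g h t : G} {a : A} (ha : a ∈ Θ.D g⁻¹ * (Θ.D h * Θ.D (h * t)))
    (m : Multiplier k ↥(Θ.D h * Θ.D (h * t))) :
    (m.right ⟨a, AlgIdeal.mem_right_of_mem_mul ha⟩ : A) ∈ Θ.D g⁻¹ * Θ.D (h * t) :=
  AlgIdeal.mul_mono (fun _ h => h) (fun _ h => AlgIdeal.mem_right_of_mem_mul h)
    (Multiplier.right_mem (Θ.mul_idem h (h * t)) m
      (x := ⟨a, AlgIdeal.mem_right_of_mem_mul ha⟩) ha)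

theorem mem_vi₂ {g h t : G} {a : A} (ha : a ∈ Θ.D g⁻¹ * (Θ.D h * Θ.D (h * t))) :
    a ∈ Θ.D g⁻¹ * Θ.D h :=
  AlgIdeal.mul_mono (fun _ h => h) (fun _ h => AlgIdeal.mem_left_of_mem_mul h) ha

theorem mem_vi₃ {g h t : G} {a : A} (ha : a ∈ Θ.D g⁻¹ * (Θ.D h * Θ.D (h * t)))
    (m : Multiplier k ↥(Θ.D g * Θ.D (g * h))) :
    (m.right (Θ.θres g h a (Θ.mem_vi₂ ha)) : A) ∈ Θ.D (g * h) * Θ.D (g * h * t) := by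
  have h1 : (Θ.θ g ⟨a, AlgIdeal.mem_left_of_mem_mul ha⟩ : A) ∈
      Θ.D (g * h * t) * (Θ.D g * Θ.D (g * h)) := by
    have h2 := Θ.θ_mem_three (x := ⟨a, AlgIdeal.mem_left_of_mem_mul ha⟩) ha
    rwa [← mul_assoc g h t, ← AlgIdeal.mul_assoc,
      AlgIdeal.mul_comm_of Θ.D_comm g (g * h) (g * h * t)] at h2
  rw [Θ.D_comm]
  exact AlgIdeal.mul_mono (fun _ h => h) (fun _ h => AlgIdeal.mem_right_of_mem_mul h)
    (Multiplier.right_mem (Θ.mul_idem g (g * h)) m (x := Θ.θres g h a (Θ.mem_vi₂ ha)) h1)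

end PartialDatum

variable (k G A) in
/-- A twisted partial action of `G` on `A`: in addition to the ideals and isomorphisms, invertible
multipliers `w g h` of `D g D (g h)` such that

* `θ g (θ h a) = w g h · θ (g h) a · (w g h)⁻¹` for `a ∈ D h⁻¹ D (g h)⁻¹`;
* `w 1 g = 1 = w g 1`;
* `θ g (a · w h t) · w g (h t) = θ g a · w g h · w (g h) t` for `a ∈ D g⁻¹ D h D (h t)`. -/
structure TwistedPartialAction extends PartialDatum k G A where
  w : ∀ g h : G, (Multiplier k ↥(D g * D (g * h)))ˣ
  θ_comp : ∀ (g h : G) (a : A) (ha : a ∈ D h⁻¹ * D (g * h)⁻¹),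
    (θ g ⟨θ h ⟨a, AlgIdeal.mem_left_of_mem_mul ha⟩, toPartialDatum.mem_iv₁ ha⟩ : A) =
      (w g h)⁻¹.val.right ((w g h).val.left
        ⟨θ (g * h) ⟨a, AlgIdeal.mem_right_of_mem_mul ha⟩, toPartialDatum.mem_iv₂ ha⟩)
  w_one_left : ∀ g : G, w 1 g = 1
  w_one_right : ∀ g : G, w g 1 = 1
  cocycle : ∀ (g h t : G) (a : A) (ha : a ∈ D g⁻¹ * (D h * D (h * t))),
    ((w g (h * t)).val.right (toPartialDatum.θres g (h * t)
        ((w h t).val.right ⟨a, AlgIdeal.mem_right_of_mem_mul ha⟩)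
        (toPartialDatum.mem_vi₁ ha (w h t).val)) : A) =
      (w (g * h) t).val.right
        ⟨(w g h).val.right (toPartialDatum.θres g h a (toPartialDatum.mem_vi₂ ha)),
          toPartialDatum.mem_vi₃ ha (w g h).val⟩

/-! ### Crossed products -/

namespace TwistedPartialAction

variable (Θ : TwistedPartialAction k G A)

/-- The underlying module `⨁ g, D g δ_g` of the crossed product. -/
def CrossedProduct : Type _ := DirectSum G fun g => ↥(Θ.D g)

noncomputable instance : AddCommGroup Θ.CrossedProduct :=
  inferInstanceAs (AddCommGroup (DirectSum G fun g => ↥(Θ.D g)))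

noncomputable instance : Module k Θ.CrossedProduct :=
  inferInstanceAs (Module k (DirectSum G fun g => ↥(Θ.D g)))

open Classical in
/-- The map `a ↦ a δ_g` from `D g` to the crossed product. -/
noncomputable def δ (g : G) : Θ.D g →ₗ[k] Θ.CrossedProduct :=
  DirectSum.lof k G (fun g => ↥(Θ.D g)) g

theorem coeff_mem {g h : G} (a : Θ.D g) (b : Θ.D h) :
    ((Θ.θ g).symm a : A) * b ∈ Θ.D g⁻¹ * Θ.D h :=
  AlgIdeal.mul_mem_mul ((Θ.θ g).symm a).2 b.2

/-- The coefficient `θ g (θ g ⁻¹ (a) b) w g h` of `(a δ_g) (b δ_h)`. -/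
def coeff (g h : G) (a : Θ.D g) (b : Θ.D h) : Θ.D (g * h) :=
  ⟨(Θ.w g h).val.right (Θ.θres g h ((Θ.θ g).symm a * b) (Θ.coeff_mem a b)),
    AlgIdeal.mem_right_of_mem_mul (SetLike.coe_mem _)⟩

theorem coeff_of_eq {g h : G} {a : Θ.D g} {b : Θ.D h} {x : A} (hx : x ∈ Θ.D g⁻¹ * Θ.D h)
    (e : ((Θ.θ g).symm a : A) * b = x) :
    (Θ.coeff g h a b : A) = (Θ.w g h).val.right (Θ.θres g h x hx) := by
  subst e
  rfl

/-- `coeff` as a bilinear map. -/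
def coeffₗ (g h : G) : Θ.D g →ₗ[k] Θ.D h →ₗ[k] Θ.D (g * h) :=
  LinearMap.mk₂ k (Θ.coeff g h)
    (fun a a' b => Subtype.ext <| by
      rw [Θ.coeff_of_eq (add_mem (Θ.coeff_mem a b) (Θ.coeff_mem a' b)) (by simp [add_mul]),
        PartialDatum.θres_add, map_add]
      rfl)
    (fun c a b => Subtype.ext <| by
      rw [Θ.coeff_of_eq (SMulMemClass.smul_mem c (Θ.coeff_mem a b))
        (by simp [smul_mul_assoc]), PartialDatum.θres_smul, map_smul]
      rfl)
    (fun a b b' => Subtype.ext <| by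
      rw [Θ.coeff_of_eq (add_mem (Θ.coeff_mem a b) (Θ.coeff_mem a b')) (by simp [mul_add]),
        PartialDatum.θres_add, map_add]
      rfl)
    (fun c a b => Subtype.ext <| by
      rw [Θ.coeff_of_eq (SMulMemClass.smul_mem c (Θ.coeff_mem a b))
        (by simp [mul_smul_comm]), PartialDatum.θres_smul, map_smul]
      rfl)

open Classical in
/-- The linear map on the crossed product given by linear maps on the summands. -/
noncomputable def lift {N : Type*} [AddCommGroup N] [Module k N] (φ : ∀ g, Θ.D g →ₗ[k] N) :
    Θ.CrossedProduct →ₗ[k] N :=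
  DirectSum.toModule k G N φ

theorem lift_δ {N : Type*} [AddCommGroup N] [Module k N] (φ : ∀ g, Θ.D g →ₗ[k] N) (g : G)
    (x : Θ.D g) : Θ.lift φ (Θ.δ g x) = φ g x := by
  classical
  exact DirectSum.toModule_lof (M := fun g => ↥(Θ.D g)) (φ := φ) k g x

/-- The multiplication of the crossed product, the bilinear extension of
`(a δ_g) (b δ_h) = θ g (θ g ⁻¹ (a) b) w g h δ_{g h}`. -/
noncomputable def mulₗ : Θ.CrossedProduct →ₗ[k] Θ.CrossedProduct →ₗ[k] Θ.CrossedProduct :=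
  Θ.lift fun g => (Θ.lift fun h => ((Θ.coeffₗ g h).compr₂ (Θ.δ (g * h))).flip).flip

noncomputable instance : NonUnitalNonAssocRing Θ.CrossedProduct :=
  { (inferInstance : AddCommGroup Θ.CrossedProduct) with
    mul := fun x y => Θ.mulₗ x y
    left_distrib := fun x y z => map_add (Θ.mulₗ x) y z
    right_distrib := fun x y z => LinearMap.map_add₂ Θ.mulₗ x y z
    zero_mul := fun x => LinearMap.map_zero₂ Θ.mulₗ x
    mul_zero := fun x => map_zero (Θ.mulₗ x) }

theorem δ_mul_δ (g h : G) (a : Θ.D g) (b : Θ.D h) :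
    Θ.δ g a * Θ.δ h b = Θ.δ (g * h) (Θ.coeff g h a b) := by
  change Θ.mulₗ (Θ.δ g a) (Θ.δ h b) = _
  rw [mulₗ, lift_δ, LinearMap.flip_apply, lift_δ]
  rfl

/-- The homogeneous component `D g δ_g` of the crossed product. -/
noncomputable def component (g : G) : Submodule k Θ.CrossedProduct :=
  LinearMap.range (Θ.δ g)

end TwistedPartialAction

end Actions

/-! ### Graded algebras -/

section Graded

variable (k : Type*) (G : Type*) (B : Type*) [CommRing k] [Group G] [NonUnitalRing B] [Module k B]

open Classical in
/-- A `G`-grading of the algebra `B`: `B` is the internal direct sum of the submodules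
`component g`, and `component g * component h ⊆ component (g h)`. -/
structure Grading where
  component : G → Submodule k B
  isInternal : DirectSum.IsInternal component
  mul_mem : ∀ {g h : G} {x y : B}, x ∈ component g → y ∈ component h → x * y ∈ component (g * h)

variable {k G B}

namespace Grading

variable (𝓑 : Grading k G B)

/-- The algebra `B₁`, the homogeneous component of the identity of `G`. -/
def unitComponent : NonUnitalSubalgebra k B :=
  { 𝓑.component 1 with
    mul_mem' := fun hx hy => by simpa using 𝓑.mul_mem hx hy }

/-- Homogeneous non-degeneracy: `x B_{g⁻¹} ≠ 0` and `B_{g⁻¹} x ≠ 0` for `0 ≠ x ∈ B_g`. -/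
def HomogeneouslyNondegenerate : Prop :=
  ∀ (g : G), ∀ x ∈ 𝓑.component g, x ≠ 0 →
    (∃ y ∈ 𝓑.component g⁻¹, x * y ≠ 0) ∧ (∃ y ∈ 𝓑.component g⁻¹, y * x ≠ 0)

/-- `𝓓_g = B_g B_{g⁻¹}`. -/
def dom (g : G) : Submodule k B := mulSub (𝓑.component g) (𝓑.component g⁻¹)

end Grading

/-- The subring `R` of `B` has local units: each `r ∈ R` lies in `e R e` for an idempotent
`e ∈ R`. -/
def HasLocalUnits (R : Submodule k B) : Prop :=
  ∀ r ∈ R, ∃ e ∈ R, e * e = e ∧ ∃ s ∈ R, r = e * s * e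

/-- Two `k`-algebras with families of homogeneous components indexed by `G` are isomorphic as
graded algebras. -/
def GradedIsomorphic {B C : Type*} [NonUnitalNonAssocRing B] [Module k B]
    [NonUnitalNonAssocRing C] [Module k C] (𝓑 : G → Submodule k B) (𝓒 : G → Submodule k C) :
    Prop :=
  ∃ e : B ≃ₗ[k] C, (∀ x y, e (x * y) = e x * e y) ∧
    ∀ g, (𝓑 g).map (e : B →ₗ[k] C) = 𝓒 g

end Graded

/-! ### Matrices with finitely many non-zero entries -/

/-- The set `FMat_X(B)` of `X × X`-matrices over `B` with finitely many non-zero entries; the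
`(i, j)`-entry of `M` is `M (i, j)`. -/
def FMat (X : Type*) (B : Type*) [Zero B] : Type _ := (X × X) →₀ B

namespace FMat

variable {X B : Type*}

instance [Zero B] : CoeFun (FMat X B) fun _ => X × X → B :=
  inferInstanceAs (CoeFun ((X × X) →₀ B) fun _ => X × X → B)

noncomputable instance [NonUnitalRing B] : AddCommGroup (FMat X B) :=
  inferInstanceAs (AddCommGroup ((X × X) →₀ B))

noncomputable instance {k : Type*} [CommRing k] [NonUnitalRing B] [Module k B] :
    Module k (FMat X B) :=
  inferInstanceAs (Module k ((X × X) →₀ B))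

section Ring

variable [NonUnitalRing B]

theorem exists_ne_zero {f : X → B} (h : ∑ᶠ l, f l ≠ 0) : ∃ l, f l ≠ 0 := by
  by_contra! h'
  exact h (finsum_eq_zero_of_forall_eq_zero h')

theorem finite_support (M N : FMat X B) (i j : X) :
    (Function.support fun l => M (i, l) * N (l, j)).Finite := by
  refine ((Finsupp.hasFiniteSupport (M : (X × X) →₀ B)).image Prod.snd).subset fun l hl => ?_
  exact ⟨(i, l), fun h => hl (by change M (i, l) * N (l, j) = 0; rw [show M (i, l) = 0 from h,
    zero_mul]), rfl⟩

/-- Matrix multiplication `(M N)(i, j) = ∑ l, M(i, l) N(l, j)`, a finite sum. -/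
noncomputable instance : Mul (FMat X B) :=
  ⟨fun M N => Finsupp.ofSupportFinite (fun p => ∑ᶠ l, M (p.1, l) * N (l, p.2)) (by
    refine (((Finsupp.hasFiniteSupport (M : (X × X) →₀ B)).image Prod.fst).prod
      ((Finsupp.hasFiniteSupport (N : (X × X) →₀ B)).image Prod.snd)).subset fun p hp => ?_
    obtain ⟨l, hl⟩ := exists_ne_zero hp
    exact ⟨⟨(p.1, l), left_ne_zero_of_mul hl, rfl⟩, ⟨(l, p.2), right_ne_zero_of_mul hl, rfl⟩⟩)⟩

@[ext]
theorem ext {M N : FMat X B} (h : ∀ i j, M (i, j) = N (i, j)) : M = N :=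
  Finsupp.ext fun p => h p.1 p.2

theorem mul_apply (M N : FMat X B) (i j : X) :
    (M * N) (i, j) = ∑ᶠ l, M (i, l) * N (l, j) := rfl

theorem add_apply (M N : FMat X B) (p : X × X) : (M + N) p = M p + N p := rfl

theorem zero_apply (p : X × X) : (0 : FMat X B) p = 0 := rfl

theorem smul_apply {k : Type*} [CommRing k] [Module k B] (c : k) (M : FMat X B) (p : X × X) :
    (c • M) p = c • M p := rfl

noncomputable instance : NonUnitalRing (FMat X B) :=
  { (inferInstance : AddCommGroup (FMat X B)), (inferInstance : Mul (FMat X B)) with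
    left_distrib := fun M N P => by
      ext i j
      simp only [mul_apply, add_apply, mul_add]
      exact finsum_add_distrib (finite_support M N i j) (finite_support M P i j)
    right_distrib := fun M N P => by
      ext i j
      simp only [mul_apply, add_apply, add_mul]
      exact finsum_add_distrib (finite_support M P i j) (finite_support N P i j)
    zero_mul := fun M => by
      ext i j
      simp [mul_apply, zero_apply]
    mul_zero := fun M => by
      ext i j
      simp [mul_apply, zero_apply]
    mul_assoc := fun M N P => by
      classical
      ext i j
      simp only [mul_apply]
      have hs : ∀ (Q R : FMat X B) (a b : X) (s : Finset X),
          (∀ l, Q (a, l) ≠ 0 → l ∈ s) →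
          ∑ᶠ l, Q (a, l) * R (l, b) = ∑ l ∈ s, Q (a, l) * R (l, b) := fun Q R a b s h =>
        finsum_eq_sum_of_support_subset _ fun l hl => h l (left_ne_zero_of_mul hl)
      let s : Finset X := (Finsupp.support (M : (X × X) →₀ B)).image Prod.snd
      let t : Finset X := (Finsupp.support (N : (X × X) →₀ B)).image Prod.snd
      have hM : ∀ a l, M (a, l) ≠ 0 → l ∈ s := fun a l h =>
        Finset.mem_image.2 ⟨(a, l), Finsupp.mem_support_iff.2 h, rfl⟩
      have hN : ∀ a l, N (a, l) ≠ 0 → l ∈ t := fun a l h =>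
        Finset.mem_image.2 ⟨(a, l), Finsupp.mem_support_iff.2 h, rfl⟩
      have hMN : ∀ l, (M * N) (i, l) ≠ 0 → l ∈ t := fun l h => by
        obtain ⟨m, hm⟩ := exists_ne_zero h
        exact hN m l (right_ne_zero_of_mul hm)
      have h1 : ∑ᶠ l, (∑ᶠ m, M (i, m) * N (m, l)) * P (l, j) =
          ∑ l ∈ t, (∑ᶠ m, M (i, m) * N (m, l)) * P (l, j) := hs (M * N) P i j t hMN
      have h2 : ∑ᶠ l, M (i, l) * (∑ᶠ m, N (l, m) * P (m, j)) =
          ∑ l ∈ s, M (i, l) * (∑ᶠ m, N (l, m) * P (m, j)) := hs M (N * P) i j s (hM i)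
      rw [h1, h2]
      simp only [hs M N i _ s (hM i), hs N P _ j t (hN _), Finset.sum_mul, Finset.mul_sum,
        mul_assoc]
      exact Finset.sum_comm }

variable {k : Type*} [CommRing k] [Module k B]

instance [IsScalarTower k B B] : IsScalarTower k (FMat X B) (FMat X B) where
  smul_assoc c M N := by
    ext i j
    simp only [smul_eq_mul, mul_apply, smul_apply, smul_mul_assoc]
    exact (smul_finsum' c (finite_support M N i j)).symm

instance [SMulCommClass k B B] : SMulCommClass k (FMat X B) (FMat X B) where
  smul_comm c M N := by
    ext i j
    simp only [smul_eq_mul, mul_apply, smul_apply, mul_smul_comm]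
    exact smul_finsum' c (finite_support M N i j)

/-- The submodule `FMat_X(S)` of `FMat_X(B)` for a submodule `S` of `B`. -/
def submodule (X : Type*) (S : Submodule k B) : Submodule k (FMat X B) where
  carrier := {M | ∀ i j, M (i, j) ∈ S}
  add_mem' hM hN i j := S.add_mem (hM i j) (hN i j)
  zero_mem' _ _ := S.zero_mem
  smul_mem' c _ hM i j := S.smul_mem c (hM i j)

end Ring

end FMat

end TwistedPartial

universe u v w

/-! The obstruction is one-sided linearity. Left multiplication by degree `1` in a crossed product
is untwisted, because `θ_1 = id` and `w_{1,h} = 1`, so `a δ_1 ↦ a δ_g` is left linear over the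
degree-one part. Since `C_g C_{g⁻¹}` lies in `D_g δ_1`, this yields an injective `C_1`-linear map
`ψ` from `C_g C_{g⁻¹}` to `C_g` (`exists_linear_embedding`). The algebra is built so that no such
map exists, even after passing to finite matrices.

Let `Ω` be uncountable. The indices are one point `none` of degree `g`, carrying all of `Ω`, and one
point of degree `1` for each countable `S ⊆ Ω`, carrying `S`. The entry at `(p, q)` is a countably
supported function living on the sets of both `p` and `q`. As `g ≠ 1` and `g ≠ g⁻¹`, a matrix of
degree `g` lives in the row `none`, in columns indexed by countable sets.

Apply `ψ` to the idempotents `1_S` at `(none, none)`. For `x ∈ S`, linearity gives `ψ(1_{x}) = 1_{x}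
ψ(1_S)`, so a column in which `ψ(1_{x})` is non-zero is also a column of `ψ(1_S)`. The set indexing
this column contains `x`, and finitely many countable sets do not cover `Ω`, so infinitely many
columns occur. A countable `S` of points with distinct columns forces `ψ(1_S)` to have infinitely
many non-zero columns, a contradiction (`not_gradedIsomorphic_crossedProduct`). Conditions 1–3 hold
because every countable set gives a matrix unit at each pair of indices whose sets contain it. -/

namespace TwistedPartial

/-! ### Matrix units -/

namespace FMat

variable {X B : Type*} [NonUnitalRing B]

/-- The matrix with a single entry. -/
noncomputable def single (i j : X) (b : B) : FMat X B := Finsupp.single (i, j) b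

open Classical in
theorem single_apply (i j p q : X) (b : B) :
    single i j b (p, q) = if p = i ∧ q = j then b else 0 := by
  change Finsupp.single (i, j) b (p, q) = _
  rw [Finsupp.single_apply]
  simp only [Prod.mk.injEq, eq_comm]

open Classical in
theorem single_mul_apply (p q i j : X) (b : B) (M : FMat X B) :
    (single p q b * M) (i, j) = if i = p then b * M (q, j) else 0 := by
  rw [mul_apply, finsum_eq_single _ q]
  · by_cases h : i = p <;> simp [single_apply, h]
  · intro l hl
    simp [single_apply, hl]

open Classical in
theorem mul_single_apply (p q i j : X) (b : B) (M : FMat X B) :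
    (M * single p q b) (i, j) = if j = q then M (i, p) * b else 0 := by
  rw [mul_apply, finsum_eq_single _ p]
  · by_cases h : j = q <;> simp [single_apply, h]
  · intro l hl
    simp [single_apply, hl]

theorem single_mul_single (i j l : X) (a b : B) :
    single i j a * single j l b = single i l (a * b) := by
  classical
  ext p q
  rw [single_mul_apply, single_apply, single_apply]
  by_cases hp : p = i <;> by_cases hq : q = l <;> simp [hp, hq]

theorem single_ne_zero {i j : X} {b : B} (hb : b ≠ 0) : single i j b ≠ 0 := by
  classical
  intro h
  have := congrArg (fun M : FMat X B => M (i, j)) h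
  simp [single_apply, zero_apply] at this
  exact hb this

theorem exists_apply_ne_zero {M : FMat X B} (hM : M ≠ 0) : ∃ i j, M (i, j) ≠ 0 := by
  by_contra! h
  exact hM (ext fun i j => h i j)

theorem finite_ne_zero (M : FMat X B) : {p : X × X | M p ≠ 0}.Finite :=
  Finsupp.hasFiniteSupport (M : (X × X) →₀ B)

theorem sum_apply {ι : Type*} (s : Finset ι) (f : ι → FMat X B) (p : X × X) :
    (∑ i ∈ s, f i) p = ∑ i ∈ s, f i p :=
  Finsupp.finsetSum_apply s f p

theorem sum_single (M : FMat X B) :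
    ∑ p ∈ M.finite_ne_zero.toFinset, single p.1 p.2 (M p) = M := by
  classical
  ext i j
  rw [sum_apply, Finset.sum_eq_single (i, j)]
  · simp [single_apply]
  · rintro ⟨a, b⟩ - hab
    rw [single_apply, if_neg]
    rintro ⟨rfl, rfl⟩
    exact hab rfl
  · intro h
    simpa [single_apply] using h

variable {k : Type*} [CommRing k] [Module k B]

theorem single_mem_submodule {S : Submodule k B} (i j : X) {b : B} (hb : b ∈ S) :
    single i j b ∈ submodule X S := by
  classical
  intro p q
  rw [single_apply]
  split_ifs
  exacts [hb, S.zero_mem]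

end FMat

/-! ### The module `D g` inside a crossed product -/

namespace TwistedPartialAction

variable {k G A : Type*} [CommRing k] [Group G] [NonUnitalRing A] [Module k A]
  [IsScalarTower k A A] [SMulCommClass k A A] (Θ : TwistedPartialAction k G A)

theorem mem_one (a : A) : a ∈ Θ.D 1 := by
  rw [Θ.D_one]
  trivial

/-- Degrees such as `1 * h` and `h` agree only propositionally, so coefficients are compared in `A`
rather than in the ideals. -/
theorem δ_congr {g h : G} (e : g = h) {x : Θ.D g} {y : Θ.D h} (hxy : (x : A) = y) :
    Θ.δ g x = Θ.δ h y := by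
  subst e
  rw [Subtype.ext hxy]

theorem δ_injective (g : G) : Function.Injective (Θ.δ g) := by
  classical
  exact DirectSum.of_injective (β := fun g => ↥(Θ.D g)) g

theorem coeff_one_left {h : G} (a : Θ.D 1) (b : Θ.D h) : (Θ.coeff 1 h a b : A) = a * b := by
  have h1 : ((Θ.θ 1).symm a : A) = a := by
    rw [← Θ.θ_one, LinearEquiv.apply_symm_apply]
  have hx : (a : A) * b ∈ Θ.D (1 : G)⁻¹ * Θ.D h := h1 ▸ Θ.coeff_mem a b
  rw [Θ.coeff_of_eq hx (by rw [h1]), Θ.w_one_left]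
  exact Θ.θ_one _

/-- This makes `a ↦ a δ_h` left `A`-linear, which is all that the obstruction needs from the axioms
on `Θ` in degree one. -/
theorem δ_one_mul_δ {h : G} (a : A) (b : Θ.D h) :
    Θ.δ 1 ⟨a, Θ.mem_one a⟩ * Θ.δ h b = Θ.δ h ⟨a * b, (Θ.D h).mul_mem_left a b.2⟩ := by
  rw [δ_mul_δ]
  exact Θ.δ_congr (one_mul h) (Θ.coeff_one_left _ _)

/-- If a graded algebra `𝓒` is isomorphic to a crossed product, then `C_g C_{g⁻¹}` embeds
`C_1`-linearly into `C_g`. -/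
theorem exists_linear_embedding {C : Type*} [NonUnitalRing C] [Module k C]
    {𝓒 : G → Submodule k C} (hΘ : GradedIsomorphic 𝓒 Θ.component) (g : G) :
    ∃ ψ : mulSub (𝓒 g) (𝓒 g⁻¹) → 𝓒 g, (∀ r : mulSub (𝓒 g) (𝓒 g⁻¹), (r : C) ≠ 0 → (ψ r : C) ≠ 0) ∧
      ∀ s ∈ 𝓒 1, ∀ r t : mulSub (𝓒 g) (𝓒 g⁻¹), (t : C) = s * r → (ψ t : C) = s * ψ r := by
  obtain ⟨e, he, hcomp⟩ := hΘ
  have hmem : ∀ {h : G} {x : C}, x ∈ 𝓒 h → ∃ a : Θ.D h, Θ.δ h a = e x := by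
    intro h x hx
    have : e x ∈ Θ.component h := hcomp h ▸ Submodule.mem_map_of_mem hx
    exact this
  have hinv : ∀ {h : G} (a : Θ.D h), e.symm (Θ.δ h a) ∈ 𝓒 h := by
    intro h a
    have : Θ.δ h a ∈ (𝓒 h).map (e : C →ₗ[k] Θ.CrossedProduct) := hcomp h ▸ ⟨a, rfl⟩
    obtain ⟨x, hx, hxa⟩ := this
    rw [← hxa]
    simpa using hx
  -- The coefficient of `(a δ_g)(b δ_{g⁻¹})` lies in `D_g D_{g g⁻¹}`, hence in `D_g`.
  have key : ∀ r : mulSub (𝓒 g) (𝓒 g⁻¹), ∃ a : Θ.D g, e r = Θ.δ 1 ⟨a, Θ.mem_one a⟩ := by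
    let P : Submodule k C :=
      (LinearMap.range ((Θ.δ 1).comp (((Θ.D g).toSubmodule.subtype).codRestrict
        (Θ.D 1).toSubmodule fun a => Θ.mem_one a))).comap (e : C →ₗ[k] Θ.CrossedProduct)
    have hP : mulSub (𝓒 g) (𝓒 g⁻¹) ≤ P := by
      refine mulSub_le.2 fun x hx y hy => ?_
      obtain ⟨a, ha⟩ := hmem hx
      obtain ⟨b, hb⟩ := hmem hy
      refine ⟨⟨Θ.coeff g g⁻¹ a b, AlgIdeal.mem_left_of_mem_mul (SetLike.coe_mem
        ((Θ.w g g⁻¹).val.right (Θ.θres g g⁻¹ _ (Θ.coeff_mem a b))))⟩, ?_⟩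
      change _ = e (x * y)
      rw [he, ← ha, ← hb, δ_mul_δ]
      exact Θ.δ_congr (mul_inv_cancel g).symm rfl
    intro r
    obtain ⟨a, ha⟩ := hP r.2
    exact ⟨a, ha.symm⟩
  choose a ha using key
  -- The embedding replaces `a δ_1` by `a δ_g`, keeping the coefficient `a ∈ D_g`.
  refine ⟨fun r => ⟨e.symm (Θ.δ g (a r)), hinv _⟩, fun r hr h0 => hr ?_, fun s hs r t hst => ?_⟩
  · have h1 : Θ.δ g (a r) = 0 := by simpa using h0
    have h2 : a r = 0 := Θ.δ_injective g (by rw [h1, map_zero])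
    have h3 : e r = 0 := by
      rw [ha, ← map_zero (Θ.δ 1)]
      exact congrArg _ (Subtype.ext (by rw [h2]; rfl))
    simpa using h3
  · obtain ⟨b, hb⟩ := hmem hs
    have h1 : Θ.δ 1 ⟨a t, Θ.mem_one _⟩ = Θ.δ 1 ⟨b * a r, Θ.mem_one _⟩ := by
      rw [← ha, hst, he, ← hb, ha]
      exact Θ.δ_one_mul_δ (b : A) ⟨a r, Θ.mem_one _⟩
    have h2 : (a t : A) = b * a r := congrArg Subtype.val (Θ.δ_injective 1 h1)
    refine e.injective ?_
    change e (e.symm (Θ.δ g (a t))) = e (s * e.symm (Θ.δ g (a r)))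
    rw [he, LinearEquiv.apply_symm_apply, LinearEquiv.apply_symm_apply, ← hb,
      Θ.δ_one_mul_δ (b : A) (a r)]
    exact Θ.δ_congr rfl h2

end TwistedPartialAction

/-! ### Matrices of countably supported functions -/

section Support

variable (k : Type*) [CommRing k] {Ω J : Type*}

/-- The `k`-valued functions with countable support contained in `T`. -/
def countablySupported (T : Set Ω) : Submodule k (Ω → k) where
  carrier := {f | (Function.support f).Countable ∧ Function.support f ⊆ T}
  add_mem' hf hg :=
    ⟨(hf.1.union hg.1).mono (Function.support_add _ _),
      (Function.support_add _ _).trans (Set.union_subset hf.2 hg.2)⟩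
  zero_mem' := by simp
  smul_mem' c f hf :=
    ⟨hf.1.mono (Function.support_const_smul_subset c f),
      (Function.support_const_smul_subset c f).trans hf.2⟩

theorem indicator_mem_countablySupported {S T : Set Ω} (hS : S.Countable) (hST : S ⊆ T) :
    S.indicator (1 : Ω → k) ∈ countablySupported k T :=
  ⟨hS.mono Set.support_indicator_subset, Set.support_indicator_subset.trans hST⟩

variable (c : J → Set Ω)

/-- The matrices whose `(p, q)`-entry is a function with countable support contained in
`c p ∩ c q`. -/
def supportAlgebra : NonUnitalSubalgebra k (FMat J (Ω → k)) where
  carrier := {M | ∀ p q, M (p, q) ∈ countablySupported k (c p ∩ c q)}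
  add_mem' hM hN p q := add_mem (hM p q) (hN p q)
  zero_mem' _ _ := Submodule.zero_mem _
  smul_mem' r _ hM p q := Submodule.smul_mem _ r (hM p q)
  mul_mem' {M N} hM hN p q := by
    rw [FMat.mul_apply]
    refine finsum_induction (· ∈ countablySupported k (c p ∩ c q)) (Submodule.zero_mem _)
      (fun _ _ => add_mem) fun l => ⟨?_, fun x hx => ?_⟩
    · exact (hM p l).1.mono (Function.support_mul_subset_left _ _)
    · exact ⟨((hM p l).2 (left_ne_zero_of_mul hx)).1, ((hN l q).2 (right_ne_zero_of_mul hx)).2⟩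

namespace supportAlgebra

noncomputable instance : NonUnitalRing (supportAlgebra k c) :=
  NonUnitalSubalgebra.toNonUnitalRing _

noncomputable instance : AddCommGroup (supportAlgebra k c) :=
  NonUnitalNonAssocRing.toAddCommGroup

noncomputable instance : AddCommMonoid (supportAlgebra k c) :=
  AddCommGroup.toAddCommMonoid

noncomputable instance : Module k (supportAlgebra k c) :=
  NonUnitalSubalgebra.instModule

variable {k c}

@[ext]
theorem ext {M N : supportAlgebra k c} (h : ∀ p q, M.1 (p, q) = N.1 (p, q)) : M = N :=
  Subtype.ext (FMat.ext h)

theorem add_apply (M N : supportAlgebra k c) (p : J × J) : (M + N).1 p = M.1 p + N.1 p := rfl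

/-- The element of `supportAlgebra k c` with a single entry. -/
noncomputable def single (p q : J) (f : Ω → k) (hf : f ∈ countablySupported k (c p ∩ c q)) :
    supportAlgebra k c :=
  ⟨FMat.single p q f, by
    classical
    intro i j
    rw [FMat.single_apply]
    split_ifs with h
    · rwa [h.1, h.2]
    · exact Submodule.zero_mem _⟩

/-- The `(p, q)`-matrix unit cut down to a countable set. -/
noncomputable def unit (p q : J) (S : Set Ω) (hS : S.Countable) (hp : S ⊆ c p) (hq : S ⊆ c q) :
    supportAlgebra k c :=
  single p q (S.indicator 1) (indicator_mem_countablySupported k hS (Set.subset_inter hp hq))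

open Classical in
theorem unit_mul_apply {p q : J} {S : Set Ω} (hS : S.Countable) (hp : S ⊆ c p) (hq : S ⊆ c q)
    (M : supportAlgebra k c) (i j : J) :
    (unit p q S hS hp hq * M).1 (i, j) =
      if i = p then S.indicator (1 : Ω → k) * M.1 (q, j) else 0 :=
  FMat.single_mul_apply _ _ _ _ _ _

theorem unit_mul_unit {p q r : J} {S : Set Ω} (hS : S.Countable) (hp : S ⊆ c p) (hq : S ⊆ c q)
    (hr : S ⊆ c r) : (unit p q S hS hp hq * unit q r S hS hq hr : supportAlgebra k c) =
      unit p r S hS hp hr := by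
  refine Subtype.ext ((FMat.single_mul_single _ _ _ _ _).trans ?_)
  congr 1
  ext x
  by_cases hx : x ∈ S <;> simp [hx]

theorem unit_mul_single {p q r : J} {S : Set Ω} (hS : S.Countable) (hp : S ⊆ c p) (hq : S ⊆ c q)
    {f : Ω → k} (hf : f ∈ countablySupported k (c q ∩ c r))
    (hf' : f ∈ countablySupported k (c p ∩ c r)) (hfS : Function.support f ⊆ S) :
    unit p q S hS hp hq * single q r f hf = single p r f hf' := by
  refine Subtype.ext ((FMat.single_mul_single _ _ _ _ _).trans ?_)
  congr 1
  ext x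
  by_cases hx : x ∈ S
  · simp [hx]
  · simp [hx, Function.notMem_support.1 fun h => hx (hfS h)]

/-- A matrix is the finite sum of its entries, and each entry alone is again in the algebra because
membership is tested entrywise. -/
theorem mem_of_single_mem (P : AddSubmonoid (supportAlgebra k c)) (M : supportAlgebra k c)
    (h : ∀ p q, M.1 (p, q) ≠ 0 → single p q (M.1 (p, q)) (M.2 p q) ∈ P) : M ∈ P := by
  have hM : M = ∑ p ∈ M.1.finite_ne_zero.toFinset, single p.1 p.2 (M.1 p) (M.2 p.1 p.2) := by
    refine Subtype.ext ?_
    rw [AddSubmonoidClass.coe_finsetSum]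
    exact (FMat.sum_single M.1).symm
  rw [hM]
  exact sum_mem fun p hp => h p.1 p.2 (by simpa using hp)

/-! ### The grading -/

variable {G : Type*} [Group G] (d : J → G)

variable (k c) in
/-- The matrices supported on the entries of degree `d p (d q)⁻¹ = h`. -/
def component (h : G) : Submodule k (supportAlgebra k c) where
  carrier := {M | ∀ p q, M.1 (p, q) ≠ 0 → d p * (d q)⁻¹ = h}
  add_mem' {M N} hM hN p q hpq := by
    by_cases h0 : M.1 (p, q) = 0
    · refine hN p q fun h1 => hpq ?_
      change M.1 (p, q) + N.1 (p, q) = 0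
      rw [h0, h1, add_zero]
    · exact hM p q h0
  zero_mem' p q h := absurd rfl h
  smul_mem' r M hM p q hpq := hM p q fun h => hpq (by
    change r • M.1 (p, q) = 0
    rw [h, smul_zero])

theorem single_mem_component {p q : J} {f : Ω → k} (hf : f ∈ countablySupported k (c p ∩ c q))
    {h : G} (hd : d p * (d q)⁻¹ = h) : single p q f hf ∈ component k c d h := by
  classical
  intro i j hij
  change FMat.single p q f (i, j) ≠ 0 at hij
  rw [FMat.single_apply] at hij
  split_ifs at hij with hpq
  · rw [hpq.1, hpq.2, hd]
  · exact absurd rfl hij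

theorem exists_of_mul_apply_ne_zero {M N : supportAlgebra k c} {p q : J}
    (h : (M * N).1 (p, q) ≠ 0) : ∃ l, M.1 (p, l) ≠ 0 ∧ N.1 (l, q) ≠ 0 := by
  obtain ⟨l, hl⟩ := FMat.exists_ne_zero h
  exact ⟨l, left_ne_zero_of_mul hl, right_ne_zero_of_mul hl⟩

-- Only the summand of degree `d p (d q)⁻¹` can contribute to the entry `(p, q)`. A family is thus
-- recovered from its sum, which is the independence of the components.
open Classical in
theorem coeAddMonoidHom_apply (x : DirectSum G fun h => component k c d h) (p q : J) :
    (DirectSum.coeAddMonoidHom (component k c d) x).1 (p, q) =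
      (x (d p * (d q)⁻¹)).1.1 (p, q) := by
  induction x using DirectSum.induction_on with
  | zero => simp
  | of h y =>
    rw [DirectSum.coeAddMonoidHom_of]
    by_cases e : d p * (d q)⁻¹ = h
    · subst e
      rw [DirectSum.of_eq_same]
    · rw [DirectSum.of_eq_of_ne _ _ _ e]
      by_contra h0
      exact e (y.2 p q h0)
  | add x y hx hy =>
    rw [map_add, DirectSum.add_apply, add_apply, hx, hy, Submodule.coe_add, add_apply]

variable (k c) in
/-- The grading of `supportAlgebra k c` with the `(p, q)`-entries in degree `d p (d q)⁻¹`. -/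
def grading : Grading k G (supportAlgebra k c) where
  component := component k c d
  isInternal := by
    classical
    refine ⟨fun x y hxy => ?_, fun M => ?_⟩
    · refine DFinsupp.ext fun h => Subtype.ext (ext fun p q => ?_)
      by_cases e : d p * (d q)⁻¹ = h
      · subst e
        rw [← coeAddMonoidHom_apply, ← coeAddMonoidHom_apply, hxy]
      · rw [not_not.1 fun h0 => e ((x h).2 p q h0), not_not.1 fun h0 => e ((y h).2 p q h0)]
    · refine mem_of_single_mem (AddMonoidHom.mrange
        (DirectSum.coeAddMonoidHom (component k c d))) M fun p q _ => ?_
      exact ⟨DirectSum.of (fun h => component k c d h) _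
        ⟨_, single_mem_component d (M.2 p q) rfl⟩, DirectSum.coeAddMonoidHom_of _ _ _⟩
  mul_mem hx hy p q hpq := by
    obtain ⟨l, h1, h2⟩ := exists_of_mul_apply_ne_zero hpq
    rw [← hx p l h1, ← hy l q h2]
    group

/-! ### Non-degeneracy, `B_h B_{h⁻¹} B_h = B_h`, and local units -/

theorem homogeneouslyNondegenerate [Nontrivial k] :
    (grading k c d).HomogeneouslyNondegenerate := by
  classical
  intro h M hM hM0
  obtain ⟨p, q, hpq⟩ := FMat.exists_apply_ne_zero (M := M.1) fun h0 => hM0 (Subtype.ext h0)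
  -- The `(q, p)`-matrix unit at a point `x` where the entry does not vanish detects `M` from either
  -- side.
  obtain ⟨x, hx⟩ := Function.ne_iff.1 hpq
  have hxc := (M.2 p q).2 hx
  have hp : {x} ⊆ c p := Set.singleton_subset_iff.2 hxc.1
  have hq : {x} ⊆ c q := Set.singleton_subset_iff.2 hxc.2
  have hd : d q * (d p)⁻¹ = h⁻¹ := by
    rw [← hM p q hpq]
    group
  refine ⟨⟨unit q p {x} (Set.countable_singleton x) hq hp, single_mem_component d _ hd,
    fun h0 => hx ?_⟩, ⟨unit q p {x} (Set.countable_singleton x) hq hp,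
    single_mem_component d _ hd, fun h0 => hx ?_⟩⟩
  · have h1 : (M.1 * FMat.single q p (({x} : Set Ω).indicator (1 : Ω → k)) : FMat J (Ω → k)) (p, p) = 0 :=
      congrArg (fun N : supportAlgebra k c => N.1 (p, p)) h0
    rw [FMat.mul_single_apply, if_pos rfl] at h1
    simpa using congrFun h1 x
  · have h1 : (FMat.single q p (({x} : Set Ω).indicator (1 : Ω → k)) * M.1 : FMat J (Ω → k)) (q, q) = 0 :=
      congrArg (fun N : supportAlgebra k c => N.1 (q, q)) h0
    rw [FMat.single_mul_apply, if_pos rfl] at h1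
    simpa using congrFun h1 x

/-- An entry `f` at `(p, q)` with support `S` is `E_{pq} 1_S · E_{qp} 1_S · E_{pq} f`; the two units
exist because `S` is countable and contained in the sets of both indices. -/
theorem mulSub_mulSub_component (h : G) :
    mulSub (mulSub ((grading k c d).component h) ((grading k c d).component h⁻¹))
      ((grading k c d).component h) = (grading k c d).component h := by
  refine le_antisymm (mulSub_le.2 fun m hm n hn => ?_) fun M hM => ?_
  · have h1 : mulSub ((grading k c d).component h) ((grading k c d).component h⁻¹) ≤
        (grading k c d).component 1 :=
      mulSub_le.2 fun x hx y hy => by simpa using (grading k c d).mul_mem hx hy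
    simpa using (grading k c d).mul_mem (h1 hm) hn
  · refine mem_of_single_mem (Submodule.toAddSubmonoid _) M fun p q hpq => ?_
    have hS := (M.2 p q).1
    have hp := (M.2 p q).2.trans Set.inter_subset_left
    have hq := (M.2 p q).2.trans Set.inter_subset_right
    have hd : d p * (d q)⁻¹ = h := hM p q hpq
    have hd' : d q * (d p)⁻¹ = h⁻¹ := by
      rw [← hd]
      group
    rw [← unit_mul_single hS hp hp (M.2 p q) (M.2 p q) subset_rfl, ← unit_mul_unit hS hp hq hp]
    exact mul_mem_mulSub (mul_mem_mulSub (single_mem_component d _ hd)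
      (single_mem_component d _ hd')) (single_mem_component d _ hd)

/-- An element involves finitely many indices and its entries have a countable total support `T`, so
a diagonal matrix of indicators of `T ∩ c p` fixes it. Hypothesis `hc` puts these diagonal entries
into `B_h B_{h⁻¹}`: they factor through an index of the right degree whose set is large enough. -/
theorem hasLocalUnits_dom
    (hc : ∀ l (T : Set Ω), T.Countable → ∃ l', d l' = d l ∧ T ⊆ c l') (h : G) :
    HasLocalUnits ((grading k c d).dom h) := by
  classical
  have hunit : ∀ (p l : J), d p * (d l)⁻¹ = h → ∀ (T : Set Ω) (hT : T.Countable) (hp : T ⊆ c p),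
      unit p p T hT hp hp ∈ (grading k c d).dom h := by
    intro p l hpl T hT hp
    obtain ⟨l', hl', hTl⟩ := hc l T hT
    rw [← unit_mul_unit hT hp hTl hp]
    refine mul_mem_mulSub (single_mem_component d _ (by rw [hl', hpl]))
      (single_mem_component d _ ?_)
    rw [hl', ← hpl]
    group
  intro r hr
  -- Rows and columns met by `B_h B_{h⁻¹}` are indices `p` admitting some `l` with `d p (d l)⁻¹ =
  -- h`, which is what `hunit` requires of the indices used in `e`.
  let P : AddSubmonoid (supportAlgebra k c) :=
    { carrier := {M | ∀ p q, M.1 (p, q) ≠ 0 →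
        (∃ l, d p * (d l)⁻¹ = h) ∧ ∃ l, d q * (d l)⁻¹ = h}
      zero_mem' := fun p q h => absurd rfl h
      add_mem' := fun {M N} hM hN p q hpq => by
        by_cases h0 : M.1 (p, q) = 0
        · refine hN p q fun h1 => hpq ?_
          change M.1 (p, q) + N.1 (p, q) = 0
          rw [h0, h1, add_zero]
        · exact hM p q h0 }
  have hrP : r ∈ P := by
    refine Submodule.span_induction (p := fun x _ => x ∈ P) ?_ P.zero_mem
      (fun _ _ _ _ hx hy => P.add_mem hx hy) ?_ hr
    · rintro _ ⟨m, hm, n, hn, rfl⟩ p q hpq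
      obtain ⟨l, h1, h2⟩ := exists_of_mul_apply_ne_zero hpq
      refine ⟨⟨l, hm p l h1⟩, ⟨l, ?_⟩⟩
      rw [← inv_inv h, ← hn l q h2]
      group
    · intro a M _ hM p q hpq
      exact hM p q fun h0 => hpq (by
        change a • M.1 (p, q) = 0
        rw [h0, smul_zero])
  let Z : Finset (J × J) := r.1.finite_ne_zero.toFinset
  have hZ : ∀ p q, (p, q) ∈ Z ↔ r.1 (p, q) ≠ 0 := fun p q => by simp [Z]
  let F : Finset J := Z.image Prod.fst ∪ Z.image Prod.snd
  let T : Set Ω := ⋃ z ∈ Z, Function.support (r.1 z)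
  have hT : T.Countable := Z.countable_toSet.biUnion fun z _ => (r.2 z.1 z.2).1
  have hTp : ∀ p, (T ∩ c p).Countable := fun p => hT.mono Set.inter_subset_left
  have hF : ∀ p ∈ F, ∃ l, d p * (d l)⁻¹ = h := by
    intro p hp
    rcases Finset.mem_union.1 hp with hp | hp <;> obtain ⟨⟨i, j⟩, hij, rfl⟩ := Finset.mem_image.1 hp
    · exact (hrP i j ((hZ i j).1 hij)).1
    · exact (hrP i j ((hZ i j).1 hij)).2
  let e : supportAlgebra k c := ∑ p ∈ F,
    unit p p (T ∩ c p) (hTp p) Set.inter_subset_right Set.inter_subset_right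
  have he_coe : e.1 = ∑ p ∈ F, FMat.single p p ((T ∩ c p).indicator (1 : Ω → k)) :=
    AddSubmonoidClass.coe_finsetSum _ _
  have hleft : ∀ (M : FMat J (Ω → k)) i j,
      (e.1 * M) (i, j) = if i ∈ F then (T ∩ c i).indicator (1 : Ω → k) * M (i, j) else 0 := by
    intro M i j
    rw [he_coe, Finset.sum_mul, FMat.sum_apply]
    simp only [FMat.single_mul_apply]
    rw [Finset.sum_ite_eq]
  have hright : ∀ (M : FMat J (Ω → k)) i j,
      (M * e.1) (i, j) = if j ∈ F then M (i, j) * (T ∩ c j).indicator (1 : Ω → k) else 0 := by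
    intro M i j
    rw [he_coe, Finset.mul_sum, FMat.sum_apply]
    simp only [FMat.mul_single_apply]
    rw [Finset.sum_ite_eq]
  have he_mem : e ∈ (grading k c d).dom h := sum_mem fun p hp => by
    obtain ⟨l, hl⟩ := hF p hp
    exact hunit p l hl _ _ _
  have her : e * r = r := by
    refine ext fun i j => (hleft r.1 i j).trans ?_
    by_cases h0 : r.1 (i, j) = 0
    · simp [h0]
    have hij := (hZ i j).2 h0
    rw [if_pos (Finset.mem_union_left _ (Finset.mem_image_of_mem Prod.fst hij))]
    ext x
    by_cases hx : r.1 (i, j) x = 0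
    · simp [hx]
    · have : x ∈ T ∩ c i := ⟨Set.mem_biUnion hij hx, ((r.2 i j).2 hx).1⟩
      simp [Set.indicator_of_mem this]
  have hre : r * e = r := by
    refine ext fun i j => (hright r.1 i j).trans ?_
    by_cases h0 : r.1 (i, j) = 0
    · simp [h0]
    have hij := (hZ i j).2 h0
    rw [if_pos (Finset.mem_union_right _ (Finset.mem_image_of_mem Prod.snd hij))]
    ext x
    by_cases hx : r.1 (i, j) x = 0
    · simp [hx]
    · have : x ∈ T ∩ c j := ⟨Set.mem_biUnion hij hx, ((r.2 i j).2 hx).2⟩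
      simp [Set.indicator_of_mem this]
  have hee : e * e = e := by
    refine ext fun i j => (hleft e.1 i j).trans ?_
    have hentry : e.1 (i, j) =
        if i ∈ F then if i = j then (T ∩ c i).indicator (1 : Ω → k) else 0 else 0 := by
      rw [he_coe, FMat.sum_apply]
      simp only [FMat.single_apply]
      by_cases hij : i = j
      · subst hij
        simp [Finset.sum_ite_eq]
      · rw [Finset.sum_eq_zero fun p _ => if_neg fun h => hij (h.1.trans h.2.symm)]
        simp [hij]
    rw [hentry]
    split_ifs with h1 h2
    · ext x
      by_cases hx : x ∈ T ∩ c i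
      · simp [Set.indicator_of_mem hx]
      · simp [Set.indicator_of_notMem hx]
    · rw [mul_zero]
    · rfl
  exact ⟨e, he_mem, hee, r, hr, by rw [her, hre]⟩

end supportAlgebra

end Support

/-! ### The counterexample -/

section Counterexample

open supportAlgebra

variable (k : Type*) [CommRing k] (Ω : Type*) {G : Type*} [Group G]

/-- The whole set, and all its countable subsets. -/
def countableSets : Option {S : Set Ω // S.Countable} → Set Ω
  | none => Set.univ
  | some S => S

/-- The degree of an index: `g` for the whole set, `1` for the countable subsets. -/
def indexDegree (g : G) : Option {S : Set Ω // S.Countable} → G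
  | none => g
  | some _ => 1

-- Here it matters that all countable sets are indices: in degree `1` the given set can be exchanged
-- for `T` itself.
variable {Ω} in
theorem exists_indexDegree_eq_and_subset (g : G) (l : Option {S : Set Ω // S.Countable})
    (T : Set Ω) (hT : T.Countable) :
    ∃ l', indexDegree Ω g l' = indexDegree Ω g l ∧ T ⊆ countableSets Ω l' := by
  cases l with
  | none => exact ⟨none, rfl, Set.subset_univ _⟩
  | some S => exact ⟨some ⟨T, hT⟩, rfl, subset_rfl⟩

-- This is where `g ^ 2 ≠ 1` enters. The possible degrees of entries are `1`, `g` and `g⁻¹`, and `g`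
-- differs from the other two.
variable {Ω} in
theorem eq_none_and_eq_some_of_indexDegree {g : G} (hg : g ^ 2 ≠ 1)
    {p q : Option {S : Set Ω // S.Countable}}
    (h : indexDegree Ω g p * (indexDegree Ω g q)⁻¹ = g) : p = none ∧ ∃ T, q = some T := by
  have hg1 : g ≠ 1 := by
    rintro rfl
    simp at hg
  have hg2 : g⁻¹ ≠ g := fun h => hg (by rw [sq]; exact inv_eq_iff_mul_eq_one.1 h)
  cases p <;> cases q <;> simp [indexDegree] at h ⊢
  · exact hg1 h.symm
  · exact hg2 h
  · exact hg1 h.symm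

/-- The coefficient algebra `A` is arbitrary, since the contradiction comes from left linearity over
the degree-one component alone. -/
theorem not_gradedIsomorphic_crossedProduct [Nontrivial k] [Uncountable Ω] {g : G}
    (hg : g ^ 2 ≠ 1) {A : Type*} [NonUnitalRing A] [Module k A] [IsScalarTower k A A]
    [SMulCommClass k A A] (X : Type*) [Nonempty X] (Θ : TwistedPartialAction k G A) :
    ¬ GradedIsomorphic (fun h => FMat.submodule X
      ((grading k (countableSets Ω) (indexDegree Ω g)).component h)) Θ.component := by
  classical
  intro hΘ
  obtain ⟨ψ, hψ0, hψ⟩ := Θ.exists_linear_embedding hΘ g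
  obtain ⟨s⟩ := ‹Nonempty X›
  have hu : ∀ S : {S : Set Ω // S.Countable},
      S.1 ⊆ countableSets Ω none := fun S => Set.subset_univ _
  let a : {S : Set Ω // S.Countable} → supportAlgebra k (countableSets Ω) := fun S =>
    unit none none S.1 S.2 (hu S) (hu S)
  let u : {S : Set Ω // S.Countable} → FMat X (supportAlgebra k (countableSets Ω)) := fun S =>
    FMat.single s s (a S)
  have hu1 : ∀ S, u S ∈ FMat.submodule X
      ((grading k (countableSets Ω) (indexDegree Ω g)).component 1) := fun S =>
    FMat.single_mem_submodule s s (single_mem_component _ _ (mul_inv_cancel _))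
  have hug : ∀ S, u S ∈ mulSub
      (FMat.submodule X ((grading k (countableSets Ω) (indexDegree Ω g)).component g))
      (FMat.submodule X ((grading k (countableSets Ω) (indexDegree Ω g)).component g⁻¹)) := by
    intro S
    have hS : S.1 ⊆ countableSets Ω (some S) := subset_rfl
    have h1 : a S = unit none (some S) S.1 S.2 (hu S) hS * unit (some S) none S.1 S.2 hS (hu S) :=
      (unit_mul_unit S.2 (hu S) hS (hu S)).symm
    change FMat.single s s (a S) ∈ _
    rw [h1, ← FMat.single_mul_single s s s]
    exact mul_mem_mulSub
      (FMat.single_mem_submodule s s (single_mem_component _ _ (by simp [indexDegree])))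
      (FMat.single_mem_submodule s s (single_mem_component _ _ (by simp [indexDegree])))
  let v : {S : Set Ω // S.Countable} → FMat X (supportAlgebra k (countableSets Ω)) := fun S =>
    ψ ⟨u S, hug S⟩
  let pt : Ω → {S : Set Ω // S.Countable} := fun x => ⟨{x}, Set.countable_singleton x⟩
  -- For `x ∈ S` one has `1_{x} = 1_{x} 1_S`, and `ψ` respects left multiplication by `1_{x}`.
  have hmul : ∀ (S : {S : Set Ω // S.Countable}), ∀ x ∈ S.1, v (pt x) = u (pt x) * v S := by
    intro S x hx
    refine hψ _ (hu1 _) _ _ ?_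
    change u (pt x) = u (pt x) * u S
    refine ((FMat.single_mul_single s s s _ _).trans (congrArg _ ?_)).symm
    refine Subtype.ext ((FMat.single_mul_single _ _ _ _ _).trans (congrArg _ ?_))
    ext y
    by_cases hy : y = x
    · subst hy
      simp [pt, hx]
    · simp [pt, hy]
  have hne : ∀ x, v (pt x) ≠ 0 := by
    intro x
    refine hψ0 _ (FMat.single_ne_zero fun h0 => FMat.single_ne_zero (B := Ω → k) ?_
      (congrArg Subtype.val h0))
    intro h1
    simpa [pt] using congrFun h1 x
  -- The column is chosen from `v (pt x)` alone; `hmul` then shows that it is non-zero at `x` in `v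
  -- S` for every countable `S` containing `x`.
  have hcol : ∀ x, ∃ c : X × {S : Set Ω // S.Countable}, x ∈ c.2.1 ∧
      ∀ S : {S : Set Ω // S.Countable}, x ∈ S.1 → (v S (s, c.1)).1 (none, some c.2) x ≠ 0 := by
    intro x
    obtain ⟨i, t, hit⟩ := FMat.exists_apply_ne_zero (hne x)
    obtain ⟨p, q, hpq⟩ := FMat.exists_apply_ne_zero (M := (v (pt x) (i, t)).1)
      fun h0 => hit (Subtype.ext h0)
    obtain ⟨rfl, T, rfl⟩ := eq_none_and_eq_some_of_indexDegree hg
      ((ψ ⟨u (pt x), hug _⟩).2 i t p q hpq)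
    obtain ⟨y, hy⟩ := Function.ne_iff.1 hpq
    have key : ∀ S : {S : Set Ω // S.Countable}, x ∈ S.1 →
        y = x ∧ (v S (s, t)).1 (none, some T) y ≠ 0 := by
      intro S hxS
      rw [hmul S x hxS, FMat.single_mul_apply] at hy
      split_ifs at hy with hi
      · rw [unit_mul_apply, if_pos rfl, Pi.mul_apply] at hy
        exact ⟨Set.mem_singleton_iff.1 (Set.mem_of_indicator_ne_zero (left_ne_zero_of_mul hy)),
          right_ne_zero_of_mul hy⟩
      · exact absurd rfl hy
    obtain rfl : y = x := (key (pt x) rfl).1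
    exact ⟨(t, T), ((v (pt y) (s, t)).2 none (some T)).2 (key (pt y) rfl).2 |>.2,
      fun S hS => (key S hS).2⟩
  choose f hf hfv using hcol
  -- The sets indexing the columns in the range of `f` cover `Ω`, so a finite range would make `Ω`
  -- countable.
  have hinf : (Set.range f).Infinite := by
    intro hfin
    have : (Set.univ : Set Ω).Countable :=
      (hfin.countable.biUnion fun c _ => c.2.2).mono fun x _ =>
        Set.mem_iUnion₂.2 ⟨f x, Set.mem_range_self x, hf x⟩
    exact Set.not_countable_univ this
  let z : ℕ → Set.range f := hinf.natEmbedding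
  have hz : Function.Injective z := hinf.natEmbedding.injective
  choose x hx using fun n => (z n).2
  -- One point for each of infinitely many distinct columns; as this set is countable, `v S` is
  -- defined and must meet all of them.
  let S : {S : Set Ω // S.Countable} := ⟨Set.range x, Set.countable_range x⟩
  have hfin : {c : X × {S : Set Ω // S.Countable} |
      (v S (s, c.1)).1 (none, some c.2) ≠ 0}.Finite := by
    have h1 : {t : X | v S (s, t) ≠ 0}.Finite :=
      (v S).finite_ne_zero.preimage (f := fun t => (s, t)) (Prod.mk_right_injective s).injOn
    have h2 : ∀ t, {T : {S : Set Ω // S.Countable} |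
        (v S (s, t)).1 (none, some T) ≠ 0}.Finite := fun t =>
      (v S (s, t)).1.finite_ne_zero.preimage (f := fun T => (none, some T))
        ((Prod.mk_right_injective none).comp (Option.some_injective _)).injOn
    refine (h1.biUnion fun t _ => (h2 t).image (Prod.mk t)).subset fun c hc => ?_
    refine Set.mem_biUnion (x := c.1) (fun h0 => hc ?_) ⟨c.2, hc, rfl⟩
    rw [h0]
    rfl
  refine Set.infinite_of_injective_forall_mem (f := fun n => (z n : X × _))
    (Subtype.val_injective.comp hz) (fun n => ?_) hfin
  rw [← hx n]
  intro h0
  exact hfv (x n) S (Set.mem_range_self n) (congrFun h0 (x n))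

end Counterexample

end TwistedPartial

theorem mainTheorem10 {k : Type w} [CommRing k] [Nontrivial k] {G : Type u} [Group G]
    (g : G) (hg : g ^ 2 ≠ 1) :
    ∃ (B : Type w) (_ : NonUnitalRing B) (_ : Module k B) (_ : IsScalarTower k B B)
      (_ : SMulCommClass k B B) (𝓑 : TwistedPartial.Grading k G B),
      𝓑.HomogeneouslyNondegenerate ∧
      (∀ h : G, TwistedPartial.mulSub
        (TwistedPartial.mulSub (𝓑.component h) (𝓑.component h⁻¹)) (𝓑.component h) =
          𝓑.component h) ∧
      (∀ h : G, TwistedPartial.HasLocalUnits (𝓑.dom h)) ∧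
      ∀ (X : Type v) [Nonempty X]
        (Θ : TwistedPartial.TwistedPartialAction k G (TwistedPartial.FMat X 𝓑.unitComponent)),
        ¬ TwistedPartial.GradedIsomorphic
          (fun h => TwistedPartial.FMat.submodule X (𝓑.component h)) Θ.component := by
  -- `Set ℕ` is an uncountable set in the lowest universe, so the algebra stays in the universe of
  -- `k`.
  have : Uncountable (Set ℕ) := ⟨fun h => by
    obtain ⟨f, hf⟩ := h.exists_injective_nat
    exact Function.cantor_injective f hf⟩
  open TwistedPartial in
  exact ⟨supportAlgebra k (countableSets (Set ℕ)), inferInstance, inferInstance, inferInstance,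
    inferInstance, supportAlgebra.grading k _ (indexDegree (Set ℕ) g),
    supportAlgebra.homogeneouslyNondegenerate _, supportAlgebra.mulSub_mulSub_component _,
    supportAlgebra.hasLocalUnits_dom _ (exists_indexDegree_eq_and_subset g),
    fun X _ Θ => not_gradedIsomorphic_crossedProduct k (Set ℕ) hg X Θ⟩
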